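/- Let $G=(V,E,w)$ be a finite connected weighted graph with at least two vertices and without loops or multiple edges, where $w_{ij}=w_{ji}\ge 0$ and $w_{ij}>0$ if and only if $\{i,j\}\in E$. Write $d_i=\sum_j w_{ij}$, $\operatorname{vol}(G)=\sum_i d_i$, let $L=D-A$ be the Laplacian ($D=\operatorname{diag}(d_i)$, $A=(w_{ij})$), and $L^\dagger$ its Moore–Penrose pseudoinverse. For probability measures $\alpha,\beta$ on $V$ put $$r_{\alpha\beta}=(\alpha-\beta)^T L^\dagger(\alpha-\beta).$$ Let $(X_t)_{t\ge 0}$ be the simple random walk on $G$, i.e. the Markov chain with transition probabilities $w_{ij}/d_i$. A stopping rule $\Gamma$ assigns to each finite path $(x_0,\dots,x_k)$ a number in $[0,1]$, the probability that the walk is continued given that this path has been observed so far; $\Gamma$ also denotes the resulting (randomized) stopping time. The access time is $$H(\alpha,\beta)=\inf\{\mathbb{E}[\Gamma\mid X_0\sim\alpha] : \mathbb{E}[\Gamma\mid X_0\sim\alpha]<\infty,\ X_\Gamma\sim\beta\},$$ and $H_n(\alpha,\beta)$ denotes the expected duration of the naïve stopping rule: sample $j\sim\beta$ independently of the walk started from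 $X_0\sim\alpha$, and stop the walk when it first visits $j$ (at time $0$ if $X_0=j$). Then for all probability measures $\alpha,\beta$ on $V$ the quantities $H(\alpha,\beta)$, $H(\beta,\alpha)$, $H_n(\alpha,\beta)$, $H_n(\beta,\alpha)$ are finite (in particular the infima are taken over nonempty sets), and $$r_{\alpha\beta}\le\frac{2}{\operatorname{vol}(G)}\max\{H(\alpha,\beta),H(\beta,\alpha)\},\qquad r_{\alpha\beta}\le\frac{1}{\operatorname{vol}(G)}\bigl(H_n(\alpha,\beta)+H_n(\beta,\alpha)\bigr).$$ -/

import Mathlib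

open MeasureTheory ProbabilityTheory
open scoped ENNReal Matrix

noncomputable section

/-- `X` is a Moore–Penrose pseudoinverse of the real matrix `A`. -/
structure IsMoorePenrose {m n : Type*} [Fintype m] [Fintype n]
    (A : Matrix m n ℝ) (X : Matrix n m ℝ) : Prop where
  mul_mul_self : A * X * A = A
  self_mul_mul : X * A * X = X
  symm_left : (A * X)ᵀ = A * X
  symm_right : (X * A)ᵀ = X * A

theorem IsMoorePenrose.unique {m n : Type*} [Fintype m] [Fintype n]
    {A : Matrix m n ℝ} {X Y : Matrix n m ℝ}
    (hX : IsMoorePenrose A X) (hY : IsMoorePenrose A Y) : X = Y := by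
  have h1 : A * X = A * Y := by
    calc A * X = (A * X)ᵀ := hX.symm_left.symm
      _ = ((A * Y) * (A * X))ᵀ := by rw [← Matrix.mul_assoc, hY.mul_mul_self]
      _ = (A * X)ᵀ * (A * Y)ᵀ := Matrix.transpose_mul _ _
      _ = (A * X) * (A * Y) := by rw [hX.symm_left, hY.symm_left]
      _ = A * Y := by rw [← Matrix.mul_assoc, hX.mul_mul_self]
  have h2 : X * A = Y * A := by
    calc X * A = (X * A)ᵀ := hX.symm_right.symm
      _ = ((X * A) * (Y * A))ᵀ := by
          rw [Matrix.mul_assoc X A (Y * A), ← Matrix.mul_assoc A Y A, hY.mul_mul_self]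
      _ = (Y * A)ᵀ * (X * A)ᵀ := Matrix.transpose_mul _ _
      _ = (Y * A) * (X * A) := by rw [hX.symm_right, hY.symm_right]
      _ = Y * A := by rw [Matrix.mul_assoc, ← Matrix.mul_assoc A X A, hX.mul_mul_self]
  calc X = X * A * X := hX.self_mul_mul.symm
    _ = Y * A * X := by rw [h2]
    _ = Y * A * Y := by rw [Matrix.mul_assoc, h1, ← Matrix.mul_assoc]
    _ = Y := hY.self_mul_mul

theorem exists_isMoorePenrose_of_symm {n : Type*} [Fintype n] [DecidableEq n]
    (A : Matrix n n ℝ) (hA : A.IsHermitian) : ∃ X : Matrix n n ℝ, IsMoorePenrose A X := by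
  set U : Matrix n n ℝ := hA.eigenvectorUnitary.1 with hU
  set d := hA.eigenvalues with hd
  have hUU : Uᵀ * U = 1 := by
    have := Unitary.coe_star_mul_self hA.eigenvectorUnitary
    simpa [Matrix.star_eq_conjTranspose] using this
  have hS : A = U * Matrix.diagonal d * Uᵀ := by
    have := hA.spectral_theorem
    rw [Unitary.conjStarAlgAut_apply] at this
    simpa [Matrix.star_eq_conjTranspose, Function.comp_def] using this
  have key : ∀ a b : n → ℝ, (U * Matrix.diagonal a * Uᵀ) * (U * Matrix.diagonal b * Uᵀ)
      = U * Matrix.diagonal (fun i => a i * b i) * Uᵀ := by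
    intro a b
    calc (U * Matrix.diagonal a * Uᵀ) * (U * Matrix.diagonal b * Uᵀ)
        = U * Matrix.diagonal a * (Uᵀ * U) * Matrix.diagonal b * Uᵀ := by
          simp only [Matrix.mul_assoc]
      _ = _ := by rw [hUU, Matrix.mul_one, Matrix.mul_assoc U, Matrix.diagonal_mul_diagonal]
  refine ⟨U * Matrix.diagonal (fun i => (d i)⁻¹) * Uᵀ, ?_⟩
  rw [hS]
  constructor
  · rw [key, key]
    congr 3
    ext i
    by_cases h : d i = 0 <;> simp [h]
  · rw [key, key]
    congr 3
    ext i
    by_cases h : d i = 0 <;> simp [h]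
  · rw [key]
    simp [Matrix.transpose_mul, Matrix.mul_assoc]
  · rw [key]
    simp [Matrix.transpose_mul, Matrix.mul_assoc]

/-- A connected weighted graph on `V`, without loops or multiple edges: the underlying simple
graph, with real symmetric nonnegative weights that are positive exactly on the edges. -/
structure ConnectedWeightedGraph (V : Type*) extends SimpleGraph V where
  connected : toSimpleGraph.Connected
  weight : V → V → ℝ
  weight_nonneg : ∀ i j, 0 ≤ weight i j
  weight_symm : ∀ i j, weight i j = weight j i
  weight_pos_iff : ∀ i j, 0 < weight i j ↔ toSimpleGraph.Adj i j

/-- The measure on the finite set `V` with point masses `α i`. -/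
def massMeasure {V : Type*} [Fintype V] [MeasurableSpace V] (α : stdSimplex ℝ V) : Measure V :=
  ∑ i, ENNReal.ofReal (α i) • Measure.dirac i

instance {V : Type*} [Fintype V] [MeasurableSpace V] (α : stdSimplex ℝ V) :
    IsProbabilityMeasure (massMeasure α) := by
  constructor
  simp only [massMeasure, Measure.coe_finsetSum, Finset.sum_apply, Measure.smul_apply,
    measure_univ, smul_eq_mul, mul_one]
  have h0 : ∀ i ∈ Finset.univ, 0 ≤ α i := fun i _ => α.2.1 i
  have h1 : ∑ i, α i = 1 := α.2.2
  rw [← ENNReal.ofReal_sum_of_nonneg h0, h1, ENNReal.ofReal_one]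

namespace ConnectedWeightedGraph

variable {V : Type*} [Fintype V] (G : ConnectedWeightedGraph V)

/-- The weighted degree `d i`; non-neighbours contribute `0`. -/
def wdeg (i : V) : ℝ := ∑ j, G.weight i j

def vol : ℝ := ∑ i, G.wdeg i

/-- The Laplacian matrix `L = D - A`. -/
def laplacian [DecidableEq V] : Matrix V V ℝ :=
  Matrix.diagonal G.wdeg - Matrix.of G.weight

theorem laplacian_isHermitian [DecidableEq V] : G.laplacian.IsHermitian := by
  refine Matrix.IsHermitian.sub (Matrix.isHermitian_diagonal _) ?_
  ext i j
  simp [Matrix.conjTranspose_apply, G.weight_symm i j]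

/-- The Moore–Penrose pseudoinverse of the Laplacian. -/
def laplacianPinv [DecidableEq V] : Matrix V V ℝ :=
  (exists_isMoorePenrose_of_symm G.laplacian G.laplacian_isHermitian).choose

theorem laplacianPinv_spec [DecidableEq V] : IsMoorePenrose G.laplacian G.laplacianPinv :=
  (exists_isMoorePenrose_of_symm G.laplacian G.laplacian_isHermitian).choose_spec

/-- The effective resistance `(α - β)ᵀ L† (α - β)` between two probability measures. -/
def resistance [DecidableEq V] (α β : stdSimplex ℝ V) : ℝ :=
  (⇑α - ⇑β) ⬝ᵥ (G.laplacianPinv *ᵥ (⇑α - ⇑β))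

theorem wdeg_pos [Nontrivial V] (i : V) : 0 < G.wdeg i := by
  obtain ⟨j, hj⟩ := G.connected.preconnected.exists_adj_of_nontrivial i
  exact Finset.sum_pos' (fun k _ => G.weight_nonneg i k)
    ⟨j, Finset.mem_univ j, (G.weight_pos_iff i j).2 hj⟩

variable [Nontrivial V]

/-- The transition probabilities `w i j / d i` out of the vertex `i`. -/
def stepDist (i : V) : stdSimplex ℝ V :=
  ⟨fun j => G.weight i j / G.wdeg i,
    fun j => div_nonneg (G.weight_nonneg i j) (G.wdeg_pos i).le, by
      rw [← Finset.sum_div]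
      exact div_self (G.wdeg_pos i).ne'⟩

variable [MeasurableSpace V] [DiscreteMeasurableSpace V]

/-- The transition kernel of the simple random walk. -/
def stepKernel : Kernel V V := Kernel.ofFunOfCountable fun i => massMeasure (G.stepDist i)

instance : IsMarkovKernel G.stepKernel :=
  ⟨fun i => inferInstanceAs (IsProbabilityMeasure (massMeasure (G.stepDist i)))⟩

/-- The law, on the space of trajectories, of the simple random walk `(X t)` with `X 0 ∼ α`. -/
def walkLaw (α : stdSimplex ℝ V) : Measure (ℕ → V) :=
  Kernel.trajMeasure (X := fun _ => V) (massMeasure α) fun n =>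
    G.stepKernel.comap (fun h : Finset.Iic n → V => h ⟨n, Finset.mem_Iic.2 le_rfl⟩)
      (measurable_pi_apply _)

instance (α : stdSimplex ℝ V) : IsProbabilityMeasure (G.walkLaw α) := by
  unfold walkLaw
  infer_instance

end ConnectedWeightedGraph

/-- A stopping rule: it associates to each finite sequence `(x 0, …, x k)` of vertices the
probability in `[0, 1]` with which the walk is continued, given that it has been observed so far.
(The values on sequences that are not paths are irrelevant, as the walk follows none of them.) -/
abbrev StoppingRule (V : Type*) : Type _ := (k : ℕ) → (Fin (k + 1) → V) → unitInterval

/-- The random time at which the rule `Γ` stops the trajectory `x`, where `u 0, u 1, …` are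
the independent uniform marks in `[0, 1]` used for the decisions: having observed `x 0, …, x k`,
the walk is continued if `u k < Γ (x 0, …, x k)`, and stopped otherwise. -/
def StoppingRule.stopTime {V : Type*} (Γ : StoppingRule V) (ω : (ℕ → V) × (ℕ → unitInterval)) :
    ℕ∞ :=
  ⨅ (k : ℕ) (_ : Γ k (fun s => ω.1 s) ≤ ω.2 k), (k : ℕ∞)

/-- The hitting time of the vertex `j` by the trajectory `x`. -/
def hitTime {V : Type*} (j : V) (x : ℕ → V) : ℕ∞ := ⨅ (k : ℕ) (_ : x k = j), (k : ℕ∞)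

namespace ConnectedWeightedGraph

variable {V : Type*} [Fintype V] [Nontrivial V] [MeasurableSpace V] [DiscreteMeasurableSpace V]
  (G : ConnectedWeightedGraph V)

/-- The law of the walk from `α` together with independent uniform marks. -/
def markedWalkLaw (α : stdSimplex ℝ V) : Measure ((ℕ → V) × (ℕ → unitInterval)) :=
  (G.walkLaw α).prod (Measure.infinitePi fun _ => volume)

/-- The mean length `E[Γ]` of the rule `Γ` for the walk with `X 0 ∼ α`. -/
def meanLength (α : stdSimplex ℝ V) (Γ : StoppingRule V) : ℝ≥0∞ :=
  ∫⁻ ω, (Γ.stopTime ω : ℝ≥0∞) ∂G.markedWalkLaw α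

/-- `X_Γ ∼ β` for the walk with `X 0 ∼ α`. -/
def StopsWith (α β : stdSimplex ℝ V) (Γ : StoppingRule V) : Prop :=
  ∀ i, G.markedWalkLaw α {ω | ∃ t : ℕ, Γ.stopTime ω = t ∧ ω.1 t = i} = ENNReal.ofReal (β i)

/-- The access time `H(α, β)`. -/
def accessTime (α β : stdSimplex ℝ V) : ℝ≥0∞ :=
  ⨅ (Γ : StoppingRule V) (_ : G.meanLength α Γ < ⊤ ∧ G.StopsWith α β Γ), G.meanLength α Γ

/-- The expected duration `H_n(α, β)` of the naïve rule: sample `j ∼ β` independently of the walk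
with `X 0 ∼ α`, and stop the walk when it hits `j`. -/
def naiveTime (α β : stdSimplex ℝ V) : ℝ≥0∞ :=
  ∫⁻ p : V × (ℕ → V), (hitTime p.1 p.2 : ℝ≥0∞) ∂((massMeasure β).prod (G.walkLaw α))

end ConnectedWeightedGraph

end

/-! Let a randomized stopping time carry the walk from `α` to `β` with finite mean `T`, and let `x
j` be the expected number of times the walk is at `j` and is continued. Conservation of mass at each
vertex says that `x j / d j` solves the Poisson equation `L p = α - β`. By connectedness `p` differs
from any other solution `f` by a constant, and `p ≥ 0` then gives `∑ d j * f j - vol * f i ≤ ∑ x j =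
T` for every `i` (`potential_le_sum_of_flow`, `potential_le_of_stopping`).

Apply this to `f = L† (α - β)` for one direction and to `-f` for the other. The degree sums cancel
and leave `vol * (f i - f j) ≤ T + T'`; averaging over `i ∼ α` and `j ∼ β` gives `vol * r ≤ T + T'`
(`resistance_le_of_potential`). Both inequalities are instances: the naïve rule is a stopping time
randomized by its target, and the bound passes to the infimum over stopping rules.

Finiteness rests on the mean hitting times, which a solution of another Poisson equation bounds. The
naïve rule is then imitated by a rule of the prescribed form with the same survival probabilities,
hence the same mean length and exit law (`survival_naive`), so the infimum is over a nonempty set.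
-/

noncomputable section

/-! ### Potential theory of the Laplacian. -/

namespace ConnectedWeightedGraph

section LinearAlgebra

variable {V : Type*} [Fintype V] [DecidableEq V] (G : ConnectedWeightedGraph V)

theorem laplacian_mulVec_apply (f : V → ℝ) (i : V) :
    (G.laplacian *ᵥ f) i = ∑ j, G.weight i j * (f i - f j) := by
  simp only [laplacian, Matrix.sub_mulVec, Pi.sub_apply, Matrix.mulVec_diagonal, wdeg]
  simp [Matrix.mulVec, dotProduct, mul_sub, Finset.sum_sub_distrib, Finset.sum_mul]

/-- The kernel of the Laplacian of a connected graph consists of the constants. -/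
theorem eq_of_laplacian_mulVec_eq_zero {f : V → ℝ} (hf : G.laplacian *ᵥ f = 0) (u v : V) :
    f u = f v := by
  have : Nonempty V := ⟨u⟩
  obtain ⟨m, hm⟩ := Finite.exists_max f
  -- Maximum principle: at a maximum of `f` every summand of `L f` is nonnegative, so all vanish and
  -- each neighbour is a maximum too.
  have hadj : ∀ a b, G.Adj a b → f a = f m → f b = f m := by
    intro a b hab ha
    have h0 : ∑ j, G.weight a j * (f a - f j) = 0 := by
      rw [← G.laplacian_mulVec_apply, hf]; rfl
    have hnn : ∀ j ∈ Finset.univ, 0 ≤ G.weight a j * (f a - f j) := fun j _ =>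
      mul_nonneg (G.weight_nonneg a j) (by rw [ha]; linarith [hm j])
    have h1 := (Finset.sum_eq_zero_iff_of_nonneg hnn).1 h0 b (Finset.mem_univ b)
    have hw := (G.weight_pos_iff a b).2 hab
    rcases mul_eq_zero.1 h1 with h | h <;> linarith
  have hall : ∀ w, f w = f m := by
    intro w
    obtain ⟨p⟩ := G.connected.preconnected w m
    induction p with
    | nil => rfl
    | cons h p ih => exact hadj _ _ h.symm (ih hm hadj)
  rw [hall u, hall v]

theorem sum_laplacian_mulVec (f : V → ℝ) : ∑ i, (G.laplacian *ᵥ f) i = 0 := by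
  simp only [laplacian_mulVec_apply]
  have h : ∑ i, ∑ j, G.weight i j * (f i - f j) = ∑ i, ∑ j, -(G.weight i j * (f i - f j)) := by
    rw [Finset.sum_comm]
    refine Finset.sum_congr rfl fun i _ => Finset.sum_congr rfl fun j _ => ?_
    rw [G.weight_symm j i]; ring
  simp only [Finset.sum_neg_distrib] at h
  linarith

/-- The pseudoinverse inverts the Laplacian on vectors of zero sum. -/
theorem laplacian_mulVec_laplacianPinv {v : V → ℝ} (hv : ∑ i, v i = 0) :
    G.laplacian *ᵥ (G.laplacianPinv *ᵥ v) = v := by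
  have hP := G.laplacianPinv_spec
  have hL : G.laplacianᵀ = G.laplacian := by
    have := G.laplacian_isHermitian
    rwa [Matrix.IsHermitian, Matrix.conjTranspose_eq_transpose_of_trivial] at this
  -- Transpose of `L L† L = L`, since `L` and `L L†` are symmetric. It puts the residual `r` below
  -- in the kernel of `L`; being constant with zero sum, `r` is zero.
  have h1 : G.laplacian * (G.laplacian * G.laplacianPinv) = G.laplacian := by
    have := congrArg Matrix.transpose hP.mul_mul_self
    rwa [Matrix.transpose_mul, hP.symm_left, hL] at this
  set r : V → ℝ := v - G.laplacian *ᵥ (G.laplacianPinv *ᵥ v) with hr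
  have h0 : G.laplacian *ᵥ r = 0 := by
    rw [hr, Matrix.mulVec_sub, Matrix.mulVec_mulVec, Matrix.mulVec_mulVec, Matrix.mul_assoc, h1,
      sub_self]
  have hs : ∑ i, r i = 0 := by
    simp only [hr, Pi.sub_apply, Finset.sum_sub_distrib, hv, G.sum_laplacian_mulVec, sub_zero]
  ext i
  have hc : ∑ j, r j = Fintype.card V * r i := by
    rw [Finset.sum_congr rfl fun j _ => G.eq_of_laplacian_mulVec_eq_zero h0 j i]
    simp
  have : Nonempty V := ⟨i⟩
  have hri : r i = 0 := by
    rw [hs] at hc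
    exact (mul_eq_zero.1 hc.symm).resolve_left (by simp)
  simp only [hr, Pi.sub_apply] at hri
  linarith

/-- A nonnegative solution `x` of the conservation equation for the transport of `α` to `β`
has total mass bounded below by a potential of `α - β`. -/
theorem potential_le_sum_of_flow [Nontrivial V] {α β : stdSimplex ℝ V} {f x : V → ℝ}
    (hf : G.laplacian *ᵥ f = ⇑α - ⇑β) (hx : ∀ i, 0 ≤ x i)
    (hflow : ∀ j, ∑ i, x i * G.stepDist i j = x j + β j - α j) (i : V) :
    ∑ j, G.wdeg j * f j - G.vol * f i ≤ ∑ j, x j := by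
  set p : V → ℝ := fun j => x j / G.wdeg j with hp
  have hd : ∀ j, x j = G.wdeg j * p j := fun j => by
    rw [hp]; field_simp [(G.wdeg_pos j).ne']
  -- Symmetry of the weights turns inflow along the walk into `∑ k, w j k * p k`, so the flow
  -- equation becomes the Poisson equation.
  have hLp : G.laplacian *ᵥ p = ⇑α - ⇑β := by
    ext j
    rw [laplacian_mulVec_apply, Pi.sub_apply]
    have h2 : ∑ k, x k * G.stepDist k j = ∑ k, G.weight j k * p k := by
      refine Finset.sum_congr rfl fun k _ => ?_
      change x k * (G.weight k j / G.wdeg k) = G.weight j k * (x k / G.wdeg k)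
      rw [G.weight_symm k j]; ring
    simp only [mul_sub, Finset.sum_sub_distrib, ← Finset.sum_mul]
    rw [← h2, hflow j, hd j, wdeg]; ring
  have h0 : G.laplacian *ᵥ (p - f) = 0 := by rw [Matrix.mulVec_sub, hLp, hf, sub_self]
  have hc : ∀ j, p j = f j + (p i - f i) := fun j => by
    have := G.eq_of_laplacian_mulVec_eq_zero h0 j i
    simp only [Pi.sub_apply] at this; linarith
  have hvol : 0 ≤ G.vol := Finset.sum_nonneg fun j _ => (G.wdeg_pos j).le
  have hpi : 0 ≤ p i := div_nonneg (hx i) (G.wdeg_pos i).le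
  have : ∑ j, x j = ∑ j, G.wdeg j * f j + G.vol * (p i - f i) := by
    rw [vol, Finset.sum_mul, ← Finset.sum_add_distrib]
    refine Finset.sum_congr rfl fun j _ => ?_
    rw [hd j, hc j]; ring
  rw [this]
  nlinarith [mul_nonneg hvol hpi]

/-- Potential bounds on times `T`, `T'` for the two directions yield the resistance bound. -/
theorem resistance_le_of_potential [Nontrivial V] {α β : stdSimplex ℝ V} {T T' : ℝ}
    (h : ∀ f : V → ℝ, G.laplacian *ᵥ f = ⇑α - ⇑β →
      ∀ i, ∑ j, G.wdeg j * f j - G.vol * f i ≤ T)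
    (h' : ∀ f : V → ℝ, G.laplacian *ᵥ f = ⇑β - ⇑α →
      ∀ i, ∑ j, G.wdeg j * f j - G.vol * f i ≤ T') :
    G.resistance α β ≤ 1 / G.vol * (T + T') := by
  have hα : ∑ i, α i = 1 := α.2.2
  have hβ : ∑ i, β i = 1 := β.2.2
  set f := G.laplacianPinv *ᵥ (⇑α - ⇑β) with hfdef
  have hf : G.laplacian *ᵥ f = ⇑α - ⇑β :=
    G.laplacian_mulVec_laplacianPinv (by simp [Finset.sum_sub_distrib, hα, hβ])
  have hf' : G.laplacian *ᵥ (-f) = ⇑β - ⇑α := by rw [Matrix.mulVec_neg, hf, neg_sub]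
  have hvol : 0 < G.vol := Finset.sum_pos (fun j _ => G.wdeg_pos j) Finset.univ_nonempty
  have key : ∀ i j, G.vol * (f i - f j) ≤ T + T' := fun i j => by
    have h1 := h f hf j
    have h2 := h' (-f) hf' i
    simp only [Pi.neg_apply, mul_neg, Finset.sum_neg_distrib] at h2
    linarith
  have hr : G.resistance α β = ∑ i, α i * f i - ∑ i, β i * f i := by
    simp only [resistance, ← hfdef, dotProduct, Pi.sub_apply, sub_mul, Finset.sum_sub_distrib]
  -- The resistance is the mean of `f i - f j` under the product coupling of `α` and `β`.
  have h3 : G.vol * G.resistance α β = ∑ i, ∑ j, α i * β j * (G.vol * (f i - f j)) := by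
    have e1 : ∑ i, α i * f i = ∑ i, ∑ j, α i * β j * f i := by
      refine Finset.sum_congr rfl fun i _ => ?_
      rw [← Finset.sum_mul, ← Finset.mul_sum, hβ, mul_one]
    have e2 : ∑ j, β j * f j = ∑ i, ∑ j, α i * β j * f j := by
      rw [Finset.sum_comm]
      refine Finset.sum_congr rfl fun j _ => ?_
      rw [← Finset.sum_mul, ← Finset.sum_mul, hα, one_mul]
    rw [hr, e1, e2, ← Finset.sum_sub_distrib, Finset.mul_sum]
    refine Finset.sum_congr rfl fun i _ => ?_
    rw [← Finset.sum_sub_distrib, Finset.mul_sum]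
    exact Finset.sum_congr rfl fun j _ => by ring
  have h4 : ∑ i, ∑ j, α i * β j * (G.vol * (f i - f j)) ≤ ∑ i, ∑ j, α i * β j * (T + T') :=
    Finset.sum_le_sum fun i _ => Finset.sum_le_sum fun j _ =>
      mul_le_mul_of_nonneg_left (key i j) (mul_nonneg (α.2.1 i) (β.2.1 j))
  have h5 : ∑ i, ∑ j, α i * β j * (T + T') = T + T' := by
    simp only [← Finset.sum_mul, ← Finset.mul_sum, hβ, hα, mul_one, one_mul]
  rw [one_div, ← div_eq_inv_mul, le_div_iff₀ hvol, mul_comm]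
  linarith

end LinearAlgebra

end ConnectedWeightedGraph

/-! ### Point masses and functions of finitely many coordinates. -/

theorem lintegral_massMeasure {V : Type*} [Fintype V] [MeasurableSpace V]
    [DiscreteMeasurableSpace V] (α : stdSimplex ℝ V) (g : V → ℝ≥0∞) :
    ∫⁻ i, g i ∂massMeasure α = ∑ i, ENNReal.ofReal (α i) * g i := by
  simp [massMeasure, lintegral_finsetSum_measure, lintegral_smul_measure,
    lintegral_dirac' _ (Measurable.of_discrete (f := g))]

theorem massMeasure_singleton {V : Type*} [Fintype V] [MeasurableSpace V]
    [DiscreteMeasurableSpace V] (α : stdSimplex ℝ V) (i : V) :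
    massMeasure α {i} = ENNReal.ofReal (α i) := by
  classical
  rw [← lintegral_indicator_one (measurableSet_singleton i), lintegral_massMeasure]
  simp [Set.indicator_apply]

theorem exists_comp_frestrictLe {V β : Type*} {n : ℕ} {F : (ℕ → V) → β}
    (hF : DependsOn F (Set.Iic n)) :
    ∃ g : (Finset.Iic n → V) → β, F = g ∘ Preorder.frestrictLe (π := fun _ => V) n := by
  -- The history up to `n` is extended to a trajectory by freezing it at its last vertex; `F` does
  -- not see the extension.
  refine ⟨fun h => F fun k => h ⟨min k n, Finset.mem_Iic.2 (min_le_right k n)⟩, ?_⟩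
  funext x
  refine hF fun k hk => ?_
  have : min k n = k := min_eq_left hk
  simp [Preorder.frestrictLe_apply, this]

section DependsOn

variable {V : Type*} [Fintype V] [MeasurableSpace V] [DiscreteMeasurableSpace V]

/-- A function of finitely many coordinates of a trajectory is measurable. -/
theorem measurable_of_dependsOn_Iic {β : Type*} [MeasurableSpace β] {n : ℕ} {F : (ℕ → V) → β}
    (hF : DependsOn F (Set.Iic n)) : Measurable F := by
  obtain ⟨g, rfl⟩ := exists_comp_frestrictLe hF
  exact (Measurable.of_discrete (f := g)).comp (Preorder.measurable_frestrictLe n)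

theorem measurableSet_eval_eq (n : ℕ) (i : V) : MeasurableSet {x : ℕ → V | x n = i} :=
  (measurable_pi_apply (X := fun _ : ℕ => V) n) (measurableSet_singleton i)

theorem sum_setLIntegral_eval (μ : Measure (ℕ → V)) (F : (ℕ → V) → ℝ≥0∞) (n : ℕ) :
    ∑ i, ∫⁻ x in {x | x n = i}, F x ∂μ = ∫⁻ x, F x ∂μ := by
  have hU : (⋃ i ∈ (Finset.univ : Finset V), {x : ℕ → V | x n = i}) = Set.univ := by
    ext x; simp
  rw [← lintegral_biUnion_finset _ (fun i _ => measurableSet_eval_eq n i), hU,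
    Measure.restrict_univ]
  intro i _ j _ hij
  refine Set.disjoint_left.2 fun x hx hx' => hij ?_
  exact hx.symm.trans hx'

end DependsOn

/-! ### The Markov property and conservation of mass. -/

namespace ConnectedWeightedGraph

variable {V : Type*} [Fintype V] [Nontrivial V] [MeasurableSpace V] [DiscreteMeasurableSpace V]
  (G : ConnectedWeightedGraph V)

theorem walkLaw_map_zero (α : stdSimplex ℝ V) :
    (G.walkLaw α).map (fun x => x 0) = massMeasure α := by
  have h : (fun x : ℕ → V => x 0) =
      (fun h : Finset.Iic 0 → V => h ⟨0, by simp⟩) ∘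
        Preorder.frestrictLe (π := fun _ => V) 0 := rfl
  have hm : Measurable fun h : Finset.Iic 0 → V => h ⟨0, by simp⟩ := measurable_pi_apply _
  rw [h, ← Measure.map_map hm (Preorder.measurable_frestrictLe 0), walkLaw,
    Kernel.trajMeasure, Measure.map_comp _ _ (Preorder.measurable_frestrictLe 0),
    Kernel.traj_map_frestrictLe, Kernel.partialTraj_self, Measure.id_comp,
    Measure.map_map (measurable_pi_apply _) (MeasurableEquiv.measurable _)]
  exact Measure.map_id

theorem walkLaw_eval_zero (α : stdSimplex ℝ V) (i : V) :
    G.walkLaw α {x | x 0 = i} = ENNReal.ofReal (α i) := by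
  rw [← massMeasure_singleton, ← G.walkLaw_map_zero,
    Measure.map_apply (measurable_pi_apply 0) (measurableSet_singleton i)]
  rfl

/-- The Markov property of the walk. -/
theorem setLIntegral_walkLaw_succ (α : stdSimplex ℝ V) {n : ℕ} {F : (ℕ → V) → ℝ≥0∞}
    (hF : DependsOn F (Set.Iic n)) (j : V) :
    ∫⁻ x in {x | x (n + 1) = j}, F x ∂G.walkLaw α =
      ∑ i, (∫⁻ x in {x | x n = i}, F x ∂G.walkLaw α) * ENNReal.ofReal (G.stepDist i j) := by
  classical
  have hFm := measurable_of_dependsOn_Iic hF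
  obtain ⟨g, rfl⟩ := exists_comp_frestrictLe hF
  have hmap := Kernel.map_frestrictLe_trajMeasure_compProd_eq_map_trajMeasure
    (X := fun _ => V) (μ₀ := massMeasure α) (κ := fun n =>
    G.stepKernel.comap (fun h : Finset.Iic n → V => h ⟨n, Finset.mem_Iic.2 le_rfl⟩)
      (measurable_pi_apply _)) (a := n)
  have hmeas : Measurable fun p : (Finset.Iic n → V) × V =>
      g p.1 * ({j} : Set V).indicator 1 p.2 := Measurable.of_discrete
  have hpair : Measurable fun x : ℕ → V =>
      (Preorder.frestrictLe (π := fun _ => V) n x, x (n + 1)) :=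
    (Preorder.measurable_frestrictLe n).prodMk (measurable_pi_apply _)
  have hL := congrArg (fun m => ∫⁻ p, g p.1 * ({j} : Set V).indicator 1 p.2 ∂m) hmap
  rw [Measure.lintegral_compProd hmeas, lintegral_map hmeas hpair,
    lintegral_map Measurable.of_discrete (Preorder.measurable_frestrictLe n)] at hL
  have e1 : ∫⁻ x in {x | x (n + 1) = j}, (g ∘ Preorder.frestrictLe (π := fun _ => V) n) x
      ∂G.walkLaw α = ∫⁻ x, g (Preorder.frestrictLe (π := fun _ => V) n x) *
        ({j} : Set V).indicator 1 (x (n + 1)) ∂G.walkLaw α := by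
    rw [← lintegral_indicator (measurableSet_eval_eq (n + 1) j)]
    refine lintegral_congr fun x => ?_
    by_cases hx : x (n + 1) = j <;> simp [hx]
  rw [e1]
  refine hL.symm.trans ?_
  change ∫⁻ x, _ ∂G.walkLaw α = _
  rw [← sum_setLIntegral_eval _ _ n]
  refine Finset.sum_congr rfl fun i _ => ?_
  rw [← lintegral_mul_const _ hFm]
  refine setLIntegral_congr_fun (measurableSet_eval_eq n i) fun x hx => ?_
  have hx' : x n = i := hx
  simp only [Function.comp_apply]
  rw [lintegral_const_mul _ Measurable.of_discrete, lintegral_indicator_one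
    (measurableSet_singleton j)]
  congr 1
  rw [Kernel.comap_apply, ← massMeasure_singleton, ← hx']
  rfl

/-- Conservation of mass for the walk from `α` stopped with survival probabilities `S`: if `e n j`
is the probability of stopping at `j` at time `n` and `β` is the resulting law, then the mean
length is bounded below by any potential of `α - β`. -/
theorem potential_le_of_survival [DecidableEq V] {α β : stdSimplex ℝ V}
    {S : ℕ → (ℕ → V) → ℝ≥0∞} (hS : ∀ n, DependsOn (S n) (Set.Iic n)) {e : ℕ → V → ℝ≥0∞}
    (h0 : ∀ j, e 0 j + ∫⁻ x in {x | x 0 = j}, S 0 x ∂G.walkLaw α = ENNReal.ofReal (α j))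
    (hsucc : ∀ n j, e (n + 1) j + ∫⁻ x in {x | x (n + 1) = j}, S (n + 1) x ∂G.walkLaw α =
      ∫⁻ x in {x | x (n + 1) = j}, S n x ∂G.walkLaw α)
    (he : ∀ j, ∑' n, e n j = ENNReal.ofReal (β j))
    (hT : ∑' n, ∫⁻ x, S n x ∂G.walkLaw α ≠ ⊤) {f : V → ℝ}
    (hf : G.laplacian *ᵥ f = ⇑α - ⇑β) (i : V) :
    ∑ j, G.wdeg j * f j - G.vol * f i ≤ (∑' n, ∫⁻ x, S n x ∂G.walkLaw α).toReal := by
  -- `o n j` is the probability of being at `j` at time `n` and continuing; summed over `n` it gives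
  -- the exit frequencies `X`.
  set o : ℕ → V → ℝ≥0∞ := fun n j => ∫⁻ x in {x | x n = j}, S n x ∂G.walkLaw α with ho
  set X : V → ℝ≥0∞ := fun j => ∑' n, o n j with hX
  have hsum : ∑ j, X j = ∑' n, ∫⁻ x, S n x ∂G.walkLaw α := by
    simp only [hX]
    rw [← Summable.tsum_finsetSum fun _ _ => ENNReal.summable]
    exact tsum_congr fun n => sum_setLIntegral_eval _ _ n
  have hXtop : ∀ j, X j ≠ ⊤ := by
    rw [← hsum] at hT
    exact fun j => ENNReal.sum_ne_top.1 hT j (Finset.mem_univ j)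
  have hflow : ∀ j, ∑ i, X i * ENNReal.ofReal (G.stepDist i j) + ENNReal.ofReal (α j) =
      X j + ENNReal.ofReal (β j) := by
    intro j
    have h1 : ∑ i, X i * ENNReal.ofReal (G.stepDist i j) = ∑' n, (e (n + 1) j + o (n + 1) j) := by
      simp only [hX, ← ENNReal.tsum_mul_right]
      rw [← Summable.tsum_finsetSum fun _ _ => ENNReal.summable]
      refine tsum_congr fun n => ?_
      rw [hsucc, G.setLIntegral_walkLaw_succ α (hS n) j]
    have h2 : X j + ENNReal.ofReal (β j) = ∑' n, (e n j + o n j) := by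
      rw [ENNReal.tsum_add, he, add_comm]
    rw [h1, h2, ← h0 j, add_comm]
    -- The inflow through steps is the series over times `n + 1`; adding the start `α`, which is the
    -- term at time `0`, completes the series.
    exact (tsum_eq_zero_add' (f := fun n => e n j + o n j) ENNReal.summable).symm
  rw [← hsum, ENNReal.toReal_sum fun j _ => hXtop j]
  refine G.potential_le_sum_of_flow hf (fun j => ENNReal.toReal_nonneg) (fun j => ?_) i
  have h3 := congrArg ENNReal.toReal (hflow j)
  have htop : ∀ i ∈ Finset.univ, X i * ENNReal.ofReal (G.stepDist i j) ≠ ⊤ := fun i _ =>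
    ENNReal.mul_ne_top (hXtop i) ENNReal.ofReal_ne_top
  rw [ENNReal.toReal_add (ENNReal.sum_ne_top.2 htop) ENNReal.ofReal_ne_top,
    ENNReal.toReal_add (hXtop j) ENNReal.ofReal_ne_top, ENNReal.toReal_sum htop,
    ENNReal.toReal_ofReal (show 0 ≤ α j from α.2.1 j),
    ENNReal.toReal_ofReal (show 0 ≤ β j from β.2.1 j)] at h3
  have hP : ∀ k, 0 ≤ G.stepDist k j := fun k => (G.stepDist k).2.1 j
  simp only [ENNReal.toReal_mul, ENNReal.toReal_ofReal (hP _)] at h3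
  linarith

end ConnectedWeightedGraph

/-! ### Randomized times and their survival functions. -/

theorem ENat.toENNReal_eq_tsum (m : ℕ∞) :
    (m : ℝ≥0∞) = ∑' n : ℕ, if (n : ℕ∞) < m then 1 else 0 := by
  induction m using ENat.recTopCoe with
  | top => simp
  | coe m =>
    rw [tsum_eq_sum (s := Finset.range m) fun n hn => by simpa using hn,
      Finset.sum_congr rfl (g := fun _ => (1 : ℝ≥0∞)) fun n hn => by simpa using hn]
    simp

theorem ENat.natCast_lt_iInf_iff {p : ℕ → Prop} {n : ℕ} :
    (n : ℕ∞) < ⨅ (k : ℕ) (_ : p k), (k : ℕ∞) ↔ ∀ k ≤ n, ¬ p k := by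
  constructor
  · intro h k hk hp
    have h1 : (⨅ (k : ℕ) (_ : p k), (k : ℕ∞)) ≤ k := iInf₂_le k hp
    exact absurd (h.trans_le h1) (by simpa using hk)
  · intro h
    refine lt_of_lt_of_le (b := ((n + 1 : ℕ) : ℕ∞)) (by exact_mod_cast Nat.lt_succ_self n)
      (le_iInf₂ fun k hk => ?_)
    have : n < k := not_le.1 fun hkn => h k hkn hk
    exact_mod_cast this

/-- The conditional probability, given the trajectory `x`, that a random time `τ` depending on
`x` and on an independent mark exceeds `n`. -/
def survival {V Y : Type*} [MeasurableSpace Y] (ν : Measure Y) (τ : (ℕ → V) × Y → ℕ∞)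
    (n : ℕ) (x : ℕ → V) : ℝ≥0∞ :=
  ν {y | n < τ (x, y)}

theorem measurable_coe_enat {Ω : Type*} [MeasurableSpace Ω] {τ : Ω → ℕ∞}
    (hτ : ∀ n : ℕ, MeasurableSet {ω | (n : ℕ∞) < τ ω}) : Measurable fun ω => (τ ω : ℝ≥0∞) := by
  simp only [ENat.toENNReal_eq_tsum]
  exact Measurable.tsum fun n => Measurable.ite (hτ n) measurable_const measurable_const

theorem lintegral_coe_enat {Ω : Type*} [MeasurableSpace Ω] {μ : Measure Ω} {τ : Ω → ℕ∞}
    (hτ : ∀ n : ℕ, MeasurableSet {ω | (n : ℕ∞) < τ ω}) :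
    ∫⁻ ω, (τ ω : ℝ≥0∞) ∂μ = ∑' n : ℕ, μ {ω | (n : ℕ∞) < τ ω} := by
  simp only [ENat.toENNReal_eq_tsum]
  rw [lintegral_tsum fun n =>
    (Measurable.ite (hτ n) measurable_const measurable_const).aemeasurable]
  refine tsum_congr fun n => ?_
  rw [← lintegral_indicator_one (hτ n)]
  exact lintegral_congr fun ω => by simp [Set.indicator_apply]

theorem measurableSet_eq_natCast {Ω : Type*} [MeasurableSpace Ω] {τ : Ω → ℕ∞}
    (hτ : ∀ n : ℕ, MeasurableSet {ω | (n : ℕ∞) < τ ω}) (n : ℕ) :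
    MeasurableSet {ω | τ ω = n} := by
  have h : {ω | τ ω = n} = (fun ω => (τ ω : ℝ≥0∞)) ⁻¹' {((n : ℕ∞) : ℝ≥0∞)} := by
    ext ω
    simp only [Set.mem_ofPred_eq, Set.mem_preimage, Set.mem_singleton_iff, ENat.toENNReal_inj]
  rw [h]
  exact measurable_coe_enat hτ (measurableSet_singleton _)

theorem setLIntegral_survival_ne_top {V Y : Type*} [MeasurableSpace V] [MeasurableSpace Y]
    {μ : Measure (ℕ → V)} {ν : Measure Y} [IsProbabilityMeasure μ] [IsProbabilityMeasure ν]
    {τ : (ℕ → V) × Y → ℕ∞} (A : Set (ℕ → V)) (n : ℕ) :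
    ∫⁻ x in A, survival ν τ n x ∂μ ≠ ⊤ := by
  refine ne_top_of_le_ne_top ENNReal.one_ne_top ?_
  calc ∫⁻ x in A, survival ν τ n x ∂μ ≤ ∫⁻ _ in A, 1 ∂μ := lintegral_mono fun x => prob_le_one
    _ ≤ 1 := by rw [setLIntegral_one]; exact prob_le_one

theorem lintegral_eq_tsum_survival {V Y : Type*} [MeasurableSpace V] [MeasurableSpace Y]
    {μ : Measure (ℕ → V)} {ν : Measure Y} [SFinite ν] {τ : (ℕ → V) × Y → ℕ∞}
    (hτ : ∀ n : ℕ, MeasurableSet {ω | (n : ℕ∞) < τ ω}) :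
    ∫⁻ ω, (τ ω : ℝ≥0∞) ∂μ.prod ν = ∑' n, ∫⁻ x, survival ν τ n x ∂μ := by
  rw [lintegral_coe_enat hτ]
  exact tsum_congr fun n => Measure.prod_apply (hτ n)

theorem measure_inter_lt_eq {V Y : Type*} [MeasurableSpace V] [MeasurableSpace Y]
    {μ : Measure (ℕ → V)} {ν : Measure Y} [SFinite ν] {τ : (ℕ → V) × Y → ℕ∞}
    (hτ : ∀ n : ℕ, MeasurableSet {ω | (n : ℕ∞) < τ ω}) {A : Set (ℕ → V)} (hA : MeasurableSet A) (n : ℕ) :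
    μ.prod ν ({ω | ω.1 ∈ A} ∩ {ω | (n : ℕ∞) < τ ω}) = ∫⁻ x in A, survival ν τ n x ∂μ := by
  classical
  have hm : MeasurableSet ({ω : (ℕ → V) × Y | ω.1 ∈ A} ∩ {ω | (n : ℕ∞) < τ ω}) :=
    (measurable_fst hA).inter (hτ n)
  rw [Measure.prod_apply hm, ← lintegral_indicator hA]
  refine lintegral_congr fun x => ?_
  by_cases hx : x ∈ A <;> simp [hx, survival, Set.preimage]

section RandomTime

variable {V Y : Type*} [Fintype V] [MeasurableSpace V] [DiscreteMeasurableSpace V]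
  [MeasurableSpace Y] {μ : Measure (ℕ → V)} {ν : Measure Y} {τ : (ℕ → V) × Y → ℕ∞}

/-- The probability that the time `τ` equals `n` and the trajectory is then at `i`. -/
def exitMass (μ : Measure (ℕ → V)) (ν : Measure Y) (τ : (ℕ → V) × Y → ℕ∞) (n : ℕ) (i : V) :
    ℝ≥0∞ :=
  μ.prod ν ({ω | ω.1 ∈ {x | x n = i}} ∩ {ω | τ ω = n})

theorem measure_exit_eq_tsum (hτ : ∀ n : ℕ, MeasurableSet {ω | (n : ℕ∞) < τ ω}) (i : V) :
    μ.prod ν {ω | ∃ t : ℕ, τ ω = t ∧ ω.1 t = i} = ∑' n, exitMass μ ν τ n i := by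
  have h : {ω : (ℕ → V) × Y | ∃ t : ℕ, τ ω = t ∧ ω.1 t = i} =
      ⋃ n : ℕ, {ω | ω.1 ∈ {x | x n = i}} ∩ {ω | τ ω = n} := by
    ext ω
    simp [and_comm]
  rw [h, measure_iUnion]
  · rfl
  · intro m n hmn
    refine Set.disjoint_left.2 fun ω hm hn => hmn ?_
    have h1 : τ ω = m := hm.2
    have h2 : τ ω = n := hn.2
    exact_mod_cast h1.symm.trans h2
  · exact fun n => (measurable_fst (measurableSet_eval_eq n i)).inter (measurableSet_eq_natCast hτ n)

variable [IsProbabilityMeasure ν]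

theorem exitMass_zero_add (hτ : ∀ n : ℕ, MeasurableSet {ω | (n : ℕ∞) < τ ω}) (i : V) :
    exitMass μ ν τ 0 i + ∫⁻ x in {x | x 0 = i}, survival ν τ 0 x ∂μ = μ {x | x 0 = i} := by
  rw [← measure_inter_lt_eq hτ (measurableSet_eval_eq 0 i), exitMass, ← measure_union]
  · have h : ({ω : (ℕ → V) × Y | ω.1 ∈ {x | x 0 = i}} ∩ {ω | τ ω = (0 : ℕ)}) ∪
        ({ω | ω.1 ∈ {x | x 0 = i}} ∩ {ω | ((0 : ℕ) : ℕ∞) < τ ω}) =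
        {x : ℕ → V | x 0 = i} ×ˢ Set.univ := by
      rw [← Set.inter_union_distrib_left]
      ext ω
      simp only [Set.mem_inter_iff, Set.mem_ofPred_eq, Set.mem_union, Set.mem_prod, Set.mem_univ,
        and_true, Nat.cast_zero, and_iff_left_iff_imp]
      intro _
      rcases eq_or_ne (τ ω) 0 with h | h
      · exact Or.inl h
      · exact Or.inr (pos_iff_ne_zero.2 h)
    rw [h, Measure.prod_prod, measure_univ, mul_one]
  · refine Set.disjoint_left.2 fun ω h1 h2 => ?_
    have h3 : τ ω = (0 : ℕ) := h1.2
    exact absurd (h3 ▸ h2.2 : ((0 : ℕ) : ℕ∞) < τ ω) (by rw [h3]; exact lt_irrefl _)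
  · exact (measurable_fst (measurableSet_eval_eq 0 i)).inter (hτ 0)

/-- The event `n < τ` splits into `τ = n + 1` and `n + 1 < τ`. On the right the position is taken
one step after the survival function, which is the form the Markov property handles. -/
theorem exitMass_succ_add (hτ : ∀ n : ℕ, MeasurableSet {ω | (n : ℕ∞) < τ ω}) (n : ℕ) (i : V) :
    exitMass μ ν τ (n + 1) i + ∫⁻ x in {x | x (n + 1) = i}, survival ν τ (n + 1) x ∂μ =
      ∫⁻ x in {x | x (n + 1) = i}, survival ν τ n x ∂μ := by
  rw [← measure_inter_lt_eq hτ (measurableSet_eval_eq (n + 1) i),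
    ← measure_inter_lt_eq hτ (measurableSet_eval_eq (n + 1) i), exitMass, ← measure_union]
  · rw [← Set.inter_union_distrib_left]
    congr 2
    ext ω
    simp only [Set.mem_union, Set.mem_ofPred_eq]
    have h1 : (n : ℕ∞) < τ ω ↔ ((n + 1 : ℕ) : ℕ∞) ≤ τ ω := by
      rw [Nat.cast_succ, ENat.add_one_le_iff (ENat.natCast_ne_top n)]
    rw [h1, le_iff_eq_or_lt, eq_comm]
  · refine Set.disjoint_left.2 fun ω h1 h2 => ?_
    have h3 : τ ω = (n + 1 : ℕ) := h1.2
    have h4 : ((n + 1 : ℕ) : ℕ∞) < τ ω := h2.2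
    exact h4.ne' h3
  · exact (measurable_fst (measurableSet_eval_eq (n + 1) i)).inter (hτ (n + 1))

/-- The joint law of a random time and of the position at that time is determined by the survival
function. -/
theorem exitMass_congr [IsProbabilityMeasure μ] {Y' : Type*} [MeasurableSpace Y'] {ν' : Measure Y'}
    [IsProbabilityMeasure ν'] {τ' : (ℕ → V) × Y' → ℕ∞}
    (hτ : ∀ n : ℕ, MeasurableSet {ω | (n : ℕ∞) < τ ω})
    (hτ' : ∀ n : ℕ, MeasurableSet {ω | (n : ℕ∞) < τ' ω})
    (h : ∀ n x, survival ν τ n x = survival ν' τ' n x) (n : ℕ) (i : V) :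
    exitMass μ ν τ n i = exitMass μ ν' τ' n i := by
  -- Exit mass plus surviving mass depends only on survival functions, and the surviving mass is
  -- finite, so it cancels.
  refine (ENNReal.add_left_inj (setLIntegral_survival_ne_top (ν := ν) (τ := τ) (μ := μ)
    {x | x n = i} n)).1 ?_
  cases n with
  | zero =>
    rw [exitMass_zero_add hτ]
    simp only [h]
    rw [exitMass_zero_add hτ']
  | succ n =>
    rw [exitMass_succ_add hτ]
    simp only [h]
    rw [exitMass_succ_add hτ']

end RandomTime

namespace ConnectedWeightedGraph

variable {V : Type*} [Fintype V] [Nontrivial V] [MeasurableSpace V] [DiscreteMeasurableSpace V]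
  (G : ConnectedWeightedGraph V)

/-- A randomized stopping time that leads the walk from `α` to `β` lasts in the mean at least as
long as a potential of `α - β` prescribes. -/
theorem potential_le_of_stopping [DecidableEq V] {Y : Type*} [MeasurableSpace Y] {ν : Measure Y}
    [IsProbabilityMeasure ν] {α β : stdSimplex ℝ V} {τ : (ℕ → V) × Y → ℕ∞}
    (hτ : ∀ n : ℕ, MeasurableSet {ω | (n : ℕ∞) < τ ω})
    (hdep : ∀ n, DependsOn (survival ν τ n) (Set.Iic n))
    (hexit : ∀ i, (G.walkLaw α).prod ν {ω | ∃ t : ℕ, τ ω = t ∧ ω.1 t = i} = ENNReal.ofReal (β i))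
    (hT : ∫⁻ ω, (τ ω : ℝ≥0∞) ∂(G.walkLaw α).prod ν < ⊤) {f : V → ℝ}
    (hf : G.laplacian *ᵥ f = ⇑α - ⇑β) (i : V) :
    ∑ j, G.wdeg j * f j - G.vol * f i ≤
      (∫⁻ ω, (τ ω : ℝ≥0∞) ∂(G.walkLaw α).prod ν).toReal := by
  rw [lintegral_eq_tsum_survival hτ] at hT ⊢
  refine G.potential_le_of_survival hdep (e := exitMass (G.walkLaw α) ν τ) (fun j => ?_)
    (fun n j => exitMass_succ_add hτ n j) (fun j => ?_) hT.ne hf i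
  · rw [exitMass_zero_add hτ, walkLaw_eval_zero]
  · rw [← measure_exit_eq_tsum hτ, hexit]

end ConnectedWeightedGraph

/-! ### Hitting times and their finite mean. -/

section HittingTime

variable {V : Type*}

theorem natCast_lt_hitTime_iff {n : ℕ} {j : V} {x : ℕ → V} :
    (n : ℕ∞) < hitTime j x ↔ ∀ k ≤ n, x k ≠ j :=
  ENat.natCast_lt_iInf_iff

theorem apply_eq_of_hitTime_eq {j : V} {x : ℕ → V} {t : ℕ} (h : hitTime j x = t) : x t = j := by
  by_contra hne
  refine absurd (natCast_lt_hitTime_iff (n := t) (j := j) (x := x).2 fun k hk => ?_) h.not_gt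
  rcases hk.lt_or_eq with hlt | rfl
  · have h1 : ((k : ℕ) : ℕ∞) < hitTime j x := by rw [h]; exact_mod_cast hlt
    exact natCast_lt_hitTime_iff.1 h1 k le_rfl
  · exact hne

open Classical in
/-- The indicator of the trajectories that avoid `j` up to time `n`. -/
def avoidIndicator (j : V) (n : ℕ) (x : ℕ → V) : ℝ≥0∞ := if ∀ k ≤ n, x k ≠ j then 1 else 0

theorem dependsOn_avoidIndicator (j : V) (n : ℕ) :
    DependsOn (avoidIndicator j n) (Set.Iic n) := by
  intro x y hxy
  have h : (∀ k ≤ n, x k ≠ j) ↔ ∀ k ≤ n, y k ≠ j :=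
    forall₂_congr fun k hk => by rw [hxy k hk]
  classical
  exact if_congr h rfl rfl

theorem avoidIndicator_le_one (j : V) (n : ℕ) (x : ℕ → V) : avoidIndicator j n x ≤ 1 := by
  unfold avoidIndicator
  split_ifs <;> simp

theorem avoidIndicator_of_eq {j : V} {n : ℕ} {x : ℕ → V} (h : x n = j) :
    avoidIndicator j n x = 0 :=
  if_neg fun h' => h' n le_rfl h

theorem avoidIndicator_succ {j : V} {n : ℕ} {x : ℕ → V} (h : x (n + 1) ≠ j) :
    avoidIndicator j (n + 1) x = avoidIndicator j n x := by
  have : (∀ k ≤ n + 1, x k ≠ j) ↔ ∀ k ≤ n, x k ≠ j := by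
    refine ⟨fun h' k hk => h' k (hk.trans n.le_succ), fun h' k hk => ?_⟩
    rcases hk.lt_or_eq with hlt | rfl
    · exact h' k (Nat.lt_succ_iff.1 hlt)
    · exact h
  classical
  exact if_congr this rfl rfl

end HittingTime

namespace ConnectedWeightedGraph

variable {V : Type*} [Fintype V] [Nontrivial V] (G : ConnectedWeightedGraph V)

/-- A potential for the mean hitting times of `j`. -/
theorem exists_hitting_potential (j : V) :
    ∃ h : V → ℝ, h j = 0 ∧ ∀ i, i ≠ j → ∑ l, G.stepDist i l * h l = h i - 1 := by
  classical
  -- The right-hand side `d - vol * δ_j` has zero sum, so the Laplacian can be inverted on it. Away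
  -- from `j` the equation reads `L g = d`, that is, one step of the walk lowers `g` by `1` in the
  -- mean.
  have hs : ∑ i, (G.wdeg i - if i = j then G.vol else 0) = 0 := by
    simp [Finset.sum_sub_distrib, vol]
  set g := G.laplacianPinv *ᵥ (fun i => G.wdeg i - if i = j then G.vol else 0)
  have hg := G.laplacian_mulVec_laplacianPinv hs
  refine ⟨fun i => g i - g j, sub_self _, fun i hi => ?_⟩
  have h1 : ∑ l, G.weight i l * (g i - g l) = G.wdeg i := by
    rw [← G.laplacian_mulVec_apply, hg]
    simp [hi]
  have hd := (G.wdeg_pos i).ne'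
  have h2 : ∑ l, G.stepDist i l * (g l - g j) =
      (∑ l, G.weight i l * (g l - g j)) / G.wdeg i := by
    rw [Finset.sum_div]
    exact Finset.sum_congr rfl fun l _ => div_mul_eq_mul_div _ _ _
  have h3 : ∑ l, G.weight i l * (g l - g j) = G.wdeg i * (g i - g j) - G.wdeg i := by
    have h4 : G.wdeg i * (g i - g j) = ∑ l, G.weight i l * (g i - g j) := Finset.sum_mul _ _ _
    rw [h4]
    rw [← h1]
    rw [← Finset.sum_sub_distrib]
    exact Finset.sum_congr rfl fun l _ => by ring
  rw [h2, h3]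
  field_simp

variable [MeasurableSpace V] [DiscreteMeasurableSpace V]

/-- The walk hits every vertex in finite mean time. -/
theorem tsum_lintegral_avoidIndicator_lt_top (α : stdSimplex ℝ V) (j : V) :
    ∑' n, ∫⁻ x, avoidIndicator j n x ∂G.walkLaw α < ⊤ := by
  classical
  obtain ⟨h, hj, hh⟩ := G.exists_hitting_potential j
  set I : ℕ → V → ℝ≥0∞ := fun n i => ∫⁻ x in {x | x n = i}, avoidIndicator j n x ∂G.walkLaw α
    with hI
  set P : ℕ → ℝ≥0∞ := fun n => ∫⁻ x, avoidIndicator j n x ∂G.walkLaw α with hP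
  have hsumI : ∀ n, ∑ i, I n i = P n := fun n => sum_setLIntegral_eval _ _ n
  have hP1 : ∀ n, P n ≤ 1 := fun n => by
    calc P n ≤ ∫⁻ _, 1 ∂G.walkLaw α := lintegral_mono fun x => avoidIndicator_le_one j n x
      _ = 1 := by simp
  have hI1 : ∀ n i, I n i ≤ 1 := fun n i => by
    refine le_trans ?_ ((hsumI n).le.trans (hP1 n))
    exact Finset.single_le_sum (f := I n) (fun _ _ => zero_le) (Finset.mem_univ i)
  have hItop : ∀ n i, I n i ≠ ⊤ := fun n i => ne_top_of_le_ne_top ENNReal.one_ne_top (hI1 n i)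
  have hIj : ∀ n, I n j = 0 := fun n => by
    have : ∫⁻ x in {x | x n = j}, avoidIndicator j n x ∂G.walkLaw α =
        ∫⁻ x in {x | x n = j}, 0 ∂G.walkLaw α :=
      setLIntegral_congr_fun (measurableSet_eval_eq n j) fun x hx => avoidIndicator_of_eq hx
    simpa [hI] using this
  have hIsucc : ∀ n i, i ≠ j →
      I (n + 1) i = ∑ l, I n l * ENNReal.ofReal (G.stepDist l i) := fun n i hi => by
    rw [← G.setLIntegral_walkLaw_succ α (dependsOn_avoidIndicator j n) i]
    exact setLIntegral_congr_fun (measurableSet_eval_eq (n + 1) i) fun x hx =>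
      avoidIndicator_succ (by rw [show x (n + 1) = i from hx]; exact hi)
  have hR : ∀ n i, i ≠ j → (I (n + 1) i).toReal = ∑ l, (I n l).toReal * G.stepDist l i :=
    fun n i hi => by
      have hnn : ∀ l, 0 ≤ G.stepDist l i := fun l => (G.stepDist l).2.1 i
      rw [hIsucc n i hi, ENNReal.toReal_sum fun l _ =>
        ENNReal.mul_ne_top (hItop n l) ENNReal.ofReal_ne_top]
      simp only [ENNReal.toReal_mul, ENNReal.toReal_ofReal (hnn _)]
  -- `a n` is the mean of `h` at time `n` over trajectories that have avoided `j` so far.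
  set a : ℕ → ℝ := fun n => ∑ i, (I n i).toReal * h i with ha
  -- One step costs `1` per unit of surviving mass. The vertex `j` contributes nothing on either
  -- side: after the step because `h j = 0`, before it because no surviving mass sits at `j`.
  have hstep : ∀ n, a (n + 1) = a n - (P n).toReal := fun n => by
    have e1 : a (n + 1) = ∑ i, (∑ l, (I n l).toReal * G.stepDist l i) * h i := by
      refine Finset.sum_congr rfl fun i _ => ?_
      rcases eq_or_ne i j with rfl | hi
      · rw [hj, mul_zero, mul_zero]
      · rw [hR n i hi]
    have e2 : ∑ i, (∑ l, (I n l).toReal * G.stepDist l i) * h i =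
        ∑ l, (I n l).toReal * ∑ i, G.stepDist l i * h i := by
      simp only [Finset.sum_mul, Finset.mul_sum]
      rw [Finset.sum_comm]
      exact Finset.sum_congr rfl fun l _ => Finset.sum_congr rfl fun i _ => by ring
    rw [e1, e2, ← hsumI n, ENNReal.toReal_sum fun i _ => hItop n i, ha,
      ← Finset.sum_sub_distrib]
    refine Finset.sum_congr rfl fun l _ => ?_
    rcases eq_or_ne l j with rfl | hl
    · simp [hIj n]
    · rw [hh l hl]; ring
  -- As `a` is bounded, the telescoping sum `a 0 - a n` bounds all partial sums of the `P k` by `2 *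
  -- ∑ |h i|`.
  have hbound : ∀ n, |a n| ≤ ∑ i, |h i| := fun n => by
    refine (Finset.abs_sum_le_sum_abs _ _).trans (Finset.sum_le_sum fun i _ => ?_)
    rw [abs_mul, abs_of_nonneg ENNReal.toReal_nonneg]
    exact mul_le_of_le_one_left (abs_nonneg _)
      (ENNReal.toReal_le_of_le_ofReal zero_le_one (by simpa using hI1 n i))
  have htel : ∀ n, ∑ k ∈ Finset.range n, (P k).toReal = a 0 - a n := fun n => by
    induction n with
    | zero => simp
    | succ n ih => rw [Finset.sum_range_succ, ih, hstep n]; ring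
  refine lt_of_le_of_lt (b := ENNReal.ofReal (2 * ∑ i, |h i|)) ?_ ENNReal.ofReal_lt_top
  refine ENNReal.tsum_le_of_sum_range_le fun n => ?_
  have hPtop : ∀ k ∈ Finset.range n, P k ≠ ⊤ := fun k _ =>
    ne_top_of_le_ne_top ENNReal.one_ne_top (hP1 k)
  rw [← ENNReal.ofReal_toReal (ENNReal.sum_ne_top.2 hPtop), ENNReal.toReal_sum hPtop, htel n]
  refine ENNReal.ofReal_le_ofReal ?_
  linarith [abs_le.1 (hbound 0), abs_le.1 (hbound n)]

end ConnectedWeightedGraph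

/-! ### The naïve rule as a randomized time whose mark is the target. -/

section NaiveRule

variable {V : Type*}

/-- The duration of the naïve rule with target `ω.2`. -/
def naiveStop (ω : (ℕ → V) × V) : ℕ∞ := hitTime ω.2 ω.1

variable [Fintype V] [MeasurableSpace V] [DiscreteMeasurableSpace V]

theorem measurableSet_lt_naiveStop (n : ℕ) :
    MeasurableSet {ω : (ℕ → V) × V | (n : ℕ∞) < naiveStop ω} := by
  simp only [naiveStop, natCast_lt_hitTime_iff, Set.ofPred_forall]
  refine MeasurableSet.iInter fun k => MeasurableSet.iInter fun _ => ?_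
  have hm : Measurable fun ω : (ℕ → V) × V => (ω.1 k, ω.2) :=
    ((measurable_pi_apply k).comp measurable_fst).prodMk measurable_snd
  exact hm (MeasurableSet.of_discrete (s := {p : V × V | p.1 ≠ p.2}))

theorem survival_naiveStop (β : stdSimplex ℝ V) (n : ℕ) (x : ℕ → V) :
    survival (massMeasure β) naiveStop n x =
      ∑ j, ENNReal.ofReal (β j) * avoidIndicator j n x := by
  classical
  rw [survival, ← lintegral_indicator_one MeasurableSet.of_discrete, lintegral_massMeasure]
  refine Finset.sum_congr rfl fun j _ => ?_
  simp only [Set.indicator_apply, Set.mem_ofPred_eq, naiveStop, natCast_lt_hitTime_iff,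
    avoidIndicator, Pi.one_apply]

theorem dependsOn_survival_naiveStop (β : stdSimplex ℝ V) (n : ℕ) :
    DependsOn (survival (massMeasure β) naiveStop n) (Set.Iic n) := by
  intro x y hxy
  simp only [survival_naiveStop]
  exact Finset.sum_congr rfl fun j _ => by rw [dependsOn_avoidIndicator j n hxy]

end NaiveRule

namespace ConnectedWeightedGraph

variable {V : Type*} [Fintype V] [Nontrivial V] [MeasurableSpace V] [DiscreteMeasurableSpace V]
  (G : ConnectedWeightedGraph V)

theorem naiveTime_eq_lintegral (α β : stdSimplex ℝ V) :
    G.naiveTime α β = ∫⁻ ω, (naiveStop ω : ℝ≥0∞) ∂(G.walkLaw α).prod (massMeasure β) := by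
  rw [naiveTime, ← lintegral_prod_swap]
  rfl

theorem naiveTime_lt_top (α β : stdSimplex ℝ V) : G.naiveTime α β < ⊤ := by
  have hm : ∀ n (j : V), Measurable (avoidIndicator j n) := fun n j =>
    measurable_of_dependsOn_Iic (dependsOn_avoidIndicator j n)
  rw [naiveTime_eq_lintegral, lintegral_eq_tsum_survival measurableSet_lt_naiveStop]
  simp only [survival_naiveStop]
  have h : ∀ n, ∫⁻ x, ∑ j, ENNReal.ofReal (β j) * avoidIndicator j n x ∂G.walkLaw α =
      ∑ j, ENNReal.ofReal (β j) * ∫⁻ x, avoidIndicator j n x ∂G.walkLaw α := fun n => by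
    rw [lintegral_finsetSum _ fun j _ => (hm n j).const_mul _]
    exact Finset.sum_congr rfl fun j _ => lintegral_const_mul _ (hm n j)
  simp only [h]
  rw [Summable.tsum_finsetSum fun _ _ => ENNReal.summable]
  simp only [ENNReal.tsum_mul_left]
  exact ENNReal.sum_lt_top.2 fun j _ =>
    ENNReal.mul_lt_top ENNReal.ofReal_lt_top (G.tsum_lintegral_avoidIndicator_lt_top α j)

/-- The naïve rule stops the walk with law `β`. -/
theorem naiveStop_exit (α β : stdSimplex ℝ V) (i : V) :
    (G.walkLaw α).prod (massMeasure β) {ω | ∃ t : ℕ, naiveStop ω = t ∧ ω.1 t = i} =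
      ENNReal.ofReal (β i) := by
  have hfin := G.naiveTime_lt_top α β
  rw [naiveTime_eq_lintegral] at hfin
  have hae := ae_lt_top (measurable_coe_enat measurableSet_lt_naiveStop) hfin.ne
  -- The target is hit almost surely, and the walk then stands at it; so the exit vertex is the
  -- target itself, which has law `β`.
  have h : {ω : (ℕ → V) × V | ∃ t : ℕ, naiveStop ω = t ∧ ω.1 t = i}
      =ᵐ[(G.walkLaw α).prod (massMeasure β)] (Set.univ ×ˢ {i} : Set ((ℕ → V) × V)) := by
    filter_upwards [hae] with ω hω
    refine propext ⟨?_, fun hi => ?_⟩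
    · rintro ⟨t, ht, hti⟩
      exact ⟨Set.mem_univ _, (apply_eq_of_hitTime_eq ht).symm.trans hti⟩
    · have hne : naiveStop ω ≠ ⊤ := fun h => by simp [h] at hω
      obtain ⟨t, ht⟩ := ENat.ne_top_iff_exists.1 hne
      exact ⟨t, ht.symm, (apply_eq_of_hitTime_eq ht.symm).trans hi.2⟩
  rw [measure_congr h, Measure.prod_prod, measure_univ, one_mul, massMeasure_singleton]

theorem potential_le_naiveTime [DecidableEq V] {α β : stdSimplex ℝ V} {f : V → ℝ}
    (hf : G.laplacian *ᵥ f = ⇑α - ⇑β) (i : V) :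
    ∑ j, G.wdeg j * f j - G.vol * f i ≤ (G.naiveTime α β).toReal := by
  have hT := G.naiveTime_lt_top α β
  rw [naiveTime_eq_lintegral] at hT ⊢
  exact G.potential_le_of_stopping measurableSet_lt_naiveStop (dependsOn_survival_naiveStop β)
    (G.naiveStop_exit α β) hT hf i

end ConnectedWeightedGraph

/-! ### Survival under a stopping rule, and the rule that imitates the naïve one. -/

namespace StoppingRule

variable {V : Type*} (Γ : StoppingRule V)

theorem natCast_lt_stopTime_iff {n : ℕ} {ω : (ℕ → V) × (ℕ → unitInterval)} :
    (n : ℕ∞) < Γ.stopTime ω ↔ ∀ k ≤ n, ω.2 k < Γ k (fun s => ω.1 s) := by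
  simp only [stopTime, ENat.natCast_lt_iInf_iff, not_le]

/-- Continuing past `n` requires each mark `u k` with `k ≤ n` to lie below its threshold; the marks
are independent and uniform. -/
theorem survival_stopTime (n : ℕ) (x : ℕ → V) :
    survival (Measure.infinitePi fun _ => volume) Γ.stopTime n x =
      ∏ k ∈ Finset.Iic n, ENNReal.ofReal (Γ k fun s => x s) := by
  have h : {u : ℕ → unitInterval | (n : ℕ∞) < Γ.stopTime (x, u)} =
      Set.pi (Finset.Iic n : Finset ℕ) fun k => Set.Iio (Γ k fun s => x s) := by
    ext u
    simp [natCast_lt_stopTime_iff, Set.mem_pi]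
  rw [survival, h, Measure.infinitePi_pi _ fun _ _ => measurableSet_Iio]
  exact Finset.prod_congr rfl fun k _ => unitInterval.volume_Iio _

theorem dependsOn_survival_stopTime (n : ℕ) :
    DependsOn (survival (Measure.infinitePi fun _ => volume) Γ.stopTime n) (Set.Iic n) := by
  intro x y hxy
  simp only [survival_stopTime]
  refine Finset.prod_congr rfl fun k hk => ?_
  have : (fun s : Fin (k + 1) => x s) = fun s : Fin (k + 1) => y s :=
    funext fun s => hxy s ((Nat.lt_succ_iff.1 s.2).trans (Finset.mem_Iic.1 hk))
  rw [this]

theorem measurableSet_lt_stopTime [Fintype V] [MeasurableSpace V] [DiscreteMeasurableSpace V]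
    (n : ℕ) : MeasurableSet {ω | (n : ℕ∞) < Γ.stopTime ω} := by
  simp only [natCast_lt_stopTime_iff, Set.ofPred_forall]
  refine MeasurableSet.iInter fun k => MeasurableSet.iInter fun _ => ?_
  have h1 : Measurable fun x : ℕ → V => fun s : Fin (k + 1) => x s :=
    measurable_pi_lambda _ fun s => measurable_pi_apply _
  exact measurableSet_lt ((measurable_pi_apply k).comp measurable_snd)
    ((Measurable.of_discrete (f := Γ k)).comp (h1.comp measurable_fst))

open Classical in
/-- The mass that `β` gives to the vertices not visited by the path `y`. -/
def unvisitedMass [Fintype V] (β : stdSimplex ℝ V) {n : ℕ} (y : Fin n → V) : ℝ :=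
  ∑ j, if ∀ s, y s ≠ j then β j else 0

theorem unvisitedMass_nonneg [Fintype V] (β : stdSimplex ℝ V) {n : ℕ} (y : Fin n → V) :
    0 ≤ unvisitedMass β y :=
  Finset.sum_nonneg fun j _ => by
    split_ifs
    exacts [β.2.1 j, le_rfl]

theorem unvisitedMass_zero [Fintype V] (β : stdSimplex ℝ V) (y : Fin 0 → V) :
    unvisitedMass β y = 1 := by
  simp [unvisitedMass]

theorem unvisitedMass_succ_le [Fintype V] (β : stdSimplex ℝ V) {n : ℕ} (y : Fin (n + 1) → V) :
    unvisitedMass β y ≤ unvisitedMass β (fun s : Fin n => y s.castSucc) := by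
  refine Finset.sum_le_sum fun j _ => ?_
  have hj : 0 ≤ β j := β.2.1 j
  split_ifs with h1 h2 h2
  · exact le_rfl
  · exact absurd (fun s : Fin n => h1 s.castSucc) h2
  · exact hj
  · exact le_rfl

/-- The stopping rule that imitates the naïve rule for the target law `β`. -/
def naive [Fintype V] (β : stdSimplex ℝ V) : StoppingRule V := fun n y =>
  -- This is the conditional probability that the hidden target is not in `y`, given that it is not
  -- in `y` without its last vertex. The value `0` of `0 / 0` stops a walk that would already have
  -- stopped.
  ⟨unvisitedMass β y / unvisitedMass β (fun s : Fin n => y s.castSucc),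
    div_nonneg (unvisitedMass_nonneg β _) (unvisitedMass_nonneg β _),
    div_le_one_of_le₀ (unvisitedMass_succ_le β y) (unvisitedMass_nonneg β _)⟩

/-- The ratios telescope, starting from the mass `1` of the empty path. -/
theorem prod_naive [Fintype V] (β : stdSimplex ℝ V) (x : ℕ → V) (n : ℕ) :
    ∏ k ∈ Finset.range n, (naive β k (fun s => x s) : ℝ) =
      unvisitedMass β (fun s : Fin n => x s) := by
  induction n with
  | zero => rw [Finset.prod_range_zero, unvisitedMass_zero]
  | succ n ih =>
    rw [Finset.prod_range_succ, ih]
    change unvisitedMass β (fun s : Fin n => x s) *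
      (unvisitedMass β (fun s : Fin (n + 1) => x s) / unvisitedMass β (fun s : Fin n => x s)) = _
    -- If the denominator vanishes, the unvisited mass stays zero by monotonicity.
    rcases eq_or_ne (unvisitedMass β (fun s : Fin n => x s)) 0 with h | h
    · rw [h, zero_mul]
      refine le_antisymm (unvisitedMass_nonneg β _) ?_
      exact (unvisitedMass_succ_le β (fun s : Fin (n + 1) => x s)).trans h.le
    · exact mul_div_cancel₀ _ h

theorem survival_naive [Fintype V] [MeasurableSpace V] [DiscreteMeasurableSpace V]
    (β : stdSimplex ℝ V) (n : ℕ) (x : ℕ → V) :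
    survival (Measure.infinitePi fun _ => volume) (naive β).stopTime n x =
      survival (massMeasure β) naiveStop n x := by
  classical
  have hI : Finset.Iic n = Finset.range (n + 1) := by
    ext k; simp
  rw [survival_stopTime, survival_naiveStop, hI,
    ← ENNReal.ofReal_prod_of_nonneg fun k _ => (naive β k _).2.1, prod_naive, unvisitedMass,
    ENNReal.ofReal_sum_of_nonneg fun j _ => by
      split_ifs
      exacts [β.2.1 j, le_rfl]]
  refine Finset.sum_congr rfl fun j _ => ?_
  have h : (∀ s : Fin (n + 1), x s ≠ j) ↔ ∀ k ≤ n, x k ≠ j :=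
    ⟨fun h k hk => h ⟨k, Nat.lt_succ_iff.2 hk⟩, fun h s => h s (Nat.lt_succ_iff.1 s.2)⟩
  rw [avoidIndicator]
  by_cases h' : ∀ k ≤ n, x k ≠ j
  · rw [if_pos h', if_pos (h.2 h'), mul_one]
  · rw [if_neg h', if_neg (h.not.2 h'), ENNReal.ofReal_zero, mul_zero]

end StoppingRule

/-! ### Access times and the conclusion. -/

namespace ConnectedWeightedGraph

variable {V : Type*} [Fintype V] [Nontrivial V] [MeasurableSpace V] [DiscreteMeasurableSpace V]
  (G : ConnectedWeightedGraph V)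

theorem meanLength_naive (α β : stdSimplex ℝ V) :
    G.meanLength α (StoppingRule.naive β) = G.naiveTime α β := by
  rw [naiveTime_eq_lintegral, meanLength, markedWalkLaw,
    lintegral_eq_tsum_survival (StoppingRule.measurableSet_lt_stopTime _),
    lintegral_eq_tsum_survival measurableSet_lt_naiveStop]
  simp only [StoppingRule.survival_naive]

theorem stopsWith_naive (α β : stdSimplex ℝ V) :
    G.StopsWith α β (StoppingRule.naive β) := by
  intro i
  rw [← G.naiveStop_exit α β i, markedWalkLaw,
    measure_exit_eq_tsum (StoppingRule.measurableSet_lt_stopTime _),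
    measure_exit_eq_tsum measurableSet_lt_naiveStop]
  exact tsum_congr fun n => exitMass_congr (StoppingRule.measurableSet_lt_stopTime _)
    measurableSet_lt_naiveStop (StoppingRule.survival_naive β) n i

theorem accessTime_lt_top (α β : stdSimplex ℝ V) : G.accessTime α β < ⊤ := by
  have h : G.meanLength α (StoppingRule.naive β) < ⊤ := by
    rw [meanLength_naive]
    exact G.naiveTime_lt_top α β
  exact (iInf₂_le (StoppingRule.naive β) ⟨h, G.stopsWith_naive α β⟩).trans_lt h

/-- The left side does not depend on the rule, so bounding every admissible rule bounds the infimum;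
no optimal rule is needed. -/
theorem potential_le_accessTime [DecidableEq V] {α β : stdSimplex ℝ V} {f : V → ℝ}
    (hf : G.laplacian *ᵥ f = ⇑α - ⇑β) (i : V) :
    ∑ j, G.wdeg j * f j - G.vol * f i ≤ (G.accessTime α β).toReal := by
  refine (ENNReal.ofReal_le_iff_le_toReal (G.accessTime_lt_top α β).ne).1 ?_
  refine le_iInf₂ fun Γ hΓ => (ENNReal.ofReal_le_iff_le_toReal hΓ.1.ne).2 ?_
  exact G.potential_le_of_stopping Γ.measurableSet_lt_stopTime Γ.dependsOn_survival_stopTime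
    hΓ.2 hΓ.1 hf i

end ConnectedWeightedGraph

theorem mainTheorem7 {V : Type*} [Fintype V] [DecidableEq V] [Nontrivial V]
    [MeasurableSpace V] [DiscreteMeasurableSpace V]
    (G : ConnectedWeightedGraph V) (α β : stdSimplex ℝ V) :
    (G.accessTime α β < ⊤ ∧ G.accessTime β α < ⊤ ∧
      G.naiveTime α β < ⊤ ∧ G.naiveTime β α < ⊤) ∧
    G.resistance α β ≤
      2 / G.vol * max (G.accessTime α β).toReal (G.accessTime β α).toReal ∧
    G.resistance α β ≤
      1 / G.vol * ((G.naiveTime α β).toReal + (G.naiveTime β α).toReal) := by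
  refine ⟨⟨G.accessTime_lt_top α β, G.accessTime_lt_top β α, G.naiveTime_lt_top α β,
    G.naiveTime_lt_top β α⟩, ?_, ?_⟩
  · refine (G.resistance_le_of_potential (fun f hf i => G.potential_le_accessTime hf i)
      fun f hf i => G.potential_le_accessTime hf i).trans ?_
    have hvol : 0 ≤ 1 / G.vol :=
      one_div_nonneg.2 (Finset.sum_nonneg fun j _ => (G.wdeg_pos j).le)
    calc 1 / G.vol * ((G.accessTime α β).toReal + (G.accessTime β α).toReal)
        ≤ 1 / G.vol * (2 * max (G.accessTime α β).toReal (G.accessTime β α).toReal) := by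
          refine mul_le_mul_of_nonneg_left ?_ hvol
          rw [two_mul]
          exact add_le_add (le_max_left _ _) (le_max_right _ _)
      _ = _ := by ring
  · exact G.resistance_le_of_potential (fun f hf i => G.potential_le_naiveTime hf i)
      fun f hf i => G.potential_le_naiveTime hf i

end
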